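/- Let $\mathcal T$ be the dyadic tree of finite $0$-$1$ sequences, ordered by $\alpha\le\beta$ iff $\alpha$ is an initial segment of $\beta$. A \emph{segment} is a linearly ordered, order-convex subset of $\mathcal T$; a \emph{branch} is a maximal segment; a \emph{partition} is a family of pairwise disjoint segments. Let $JT$ be the James tree space, i.e. the completion of the space $c_{00}(\mathcal T)$ of finitely supported functions $x:\mathcal T\to\mathbb R$ under $$\|x\|_{JT}=\sup_{\mathcal P}\|x\|_{\mathcal P},\qquad \|x\|_{\mathcal P}=\Big(\sum_{S\in\mathcal P}\Big(\sum_{\alpha\in S}x(\alpha)\Big)^2\Big)^{1/2},$$ the supremum being over all partitions $\mathcal P$. For $x\in JT$, the sums $\sum_{\alpha\in S}x(\alpha)$ (in particular the coordinates $x(\alpha)$, for $S=\{\alpha\}$) are defined by continuous extension from $c_{00}(\mathcal T)$, and $\|x\|_{\mathcal P}$ by the same formula; $\operatorname{supp}(x)=\{\alpha: x(\alpha)\ne 0\}$, and $\operatorname{ran}(x)$ is the smallest order-convex subset of $\mathcal T$ containing $\operatorname{supp}(x)$. A partition $\mathcal P$ is \emph{$x$-norming} if $\|x\|_{JT}=\|x\|_{\mathcal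 P}$. The vector $x$ is \emph{separated} if for all distinct $\alpha,\beta\in\operatorname{ran}(x)$ there is an $x$-norming partition in which $\alpha$ and $\beta$ belong to different segments. A non-zero $x\in JT$ is \emph{extreme} if $x=\lambda y+(1-\lambda)z$ with $0<\lambda<1$, $y,z\in JT$ and $\|y\|_{JT}=\|z\|_{JT}=\|x\|_{JT}$ implies $x=y=z$. Put $\|x\|_2=(\sum_{\alpha\in\mathcal T}x(\alpha)^2)^{1/2}$. Let $x\in JT$ be separated. (a) If $\operatorname{supp}(x)$ is contained in a single branch, then $\|x\|_2<\infty$ and $\|x\|_{JT}=\|x\|_2$; consequently, if $x\neq 0$, then $x$ is extreme. (b) If $\operatorname{supp}(x)$ is contained in the union of a family of pairwise incomparable segments (no node of one segment of the family is comparable with a node of another), then $\|x\|_2<\infty$ and $\|x\|_{JT}=\|x\|_2$; consequently, if $x\ne0$, then $x$ is extreme. -/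

import Mathlib

noncomputable section

namespace JamesTree

/-- The dyadic tree: finite sequences of `0`'s and `1`'s, including the empty sequence. -/
def Tree : Type := List Bool

/-- The tree order: `α ≤ β` if `α` is an initial segment of `β`. -/
instance : PartialOrder Tree where
  le α β := List.IsPrefix (α : List Bool) (β : List Bool)
  le_refl α := List.prefix_refl (α : List Bool)
  le_trans _ _ _ h h' := List.IsPrefix.trans h h'
  le_antisymm _ _ h h' := h.eq_of_length (le_antisymm h.length_le h'.length_le)

/-- A segment: a set of nodes that is convex in the tree order and linearly ordered. -/
def IsSegment (S : Set Tree) : Prop :=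
  S.OrdConnected ∧ IsChain (· ≤ ·) S

/-- A branch: a maximal segment. -/
def IsBranch (b : Set Tree) : Prop :=
  Maximal IsSegment b

/-- The type of segments of the tree. -/
def Segment : Type := {S : Set Tree // IsSegment S}

/-- The set of nodes of a segment. -/
def Segment.nodes (S : Segment) : Set Tree := S.1

theorem isSegment_singleton (α : Tree) : IsSegment {α} :=
  ⟨Set.ordConnected_singleton, IsChain.singleton⟩

/-- The segment with the single node `α`. -/
def Segment.single (α : Tree) : Segment := ⟨{α}, isSegment_singleton α⟩

/-- A partition: a family of pairwise disjoint segments (it need not cover the tree). -/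
def IsPartition (P : Set Segment) : Prop :=
  P.PairwiseDisjoint Segment.nodes

/-- Two segments are incomparable if no node of one is comparable with a node of the other. -/
def Incomparable (S S' : Segment) : Prop :=
  ∀ α ∈ S.nodes, ∀ β ∈ S'.nodes, ¬ α ≤ β ∧ ¬ β ≤ α

/-- Finitely supported real functions on the tree. -/
def C00 : Type := Tree →₀ ℝ

instance : AddCommGroup C00 := inferInstanceAs (AddCommGroup (Tree →₀ ℝ))
instance : Module ℝ C00 := inferInstanceAs (Module ℝ (Tree →₀ ℝ))
instance : FunLike C00 Tree ℝ := inferInstanceAs (FunLike (Tree →₀ ℝ) Tree ℝ)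

namespace C00

/-- The finite support. -/
def support (x : C00) : Finset Tree := Finsupp.support x

/-- The sum `∑_{α ∈ S} x(α)` of a finitely supported function over a segment. -/
def segSum (S : Segment) : C00 →ₗ[ℝ] ℝ :=
  Finsupp.linearCombination ℝ (S.nodes.indicator fun _ => (1 : ℝ))

/-- The value `(∑_{S ∈ P} (∑_{α ∈ S} x(α))²)^{1/2}` of `x` at the family `P`. -/
def partValue (P : Set Segment) (x : C00) : ℝ :=
  Real.sqrt (∑' S : P, (segSum S x) ^ 2)

/-- The James tree norm: the supremum of the values at all partitions. -/
def jtNorm (x : C00) : ℝ :=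
  ⨆ P : {P : Set Segment // IsPartition P}, partValue P.1 x

theorem segSum_apply (S : Segment) (x : C00) :
    segSum S x = ∑ α ∈ support x,
      x α * S.nodes.indicator (fun _ => (1 : ℝ)) α :=
  Finsupp.linearCombination_apply ℝ (v := S.nodes.indicator fun _ => (1 : ℝ)) (show Tree →₀ ℝ from x)

/-- The `ℓ₁` norm, used only to see that the supremum is finite. -/
def l1 (x : C00) : ℝ := ∑ α ∈ support x, |x α|

theorem l1_nonneg (x : C00) : 0 ≤ l1 x := Finset.sum_nonneg fun _ _ => abs_nonneg _

theorem sum_sq_le {P : Set Segment} (hP : IsPartition P) (x : C00) (F : Finset P) :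
    ∑ S ∈ F, (segSum S x) ^ 2 ≤ l1 x ^ 2 := by
  have h1 : ∑ S ∈ F, |segSum S x| ≤ l1 x := by
    calc ∑ S ∈ F, |segSum S x|
        ≤ ∑ S ∈ F, ∑ α ∈ support x,
            |x α| * S.1.nodes.indicator (fun _ => (1 : ℝ)) α := by
          refine Finset.sum_le_sum fun S _ => ?_
          rw [segSum_apply]
          refine (Finset.abs_sum_le_sum_abs _ _).trans (Finset.sum_le_sum fun α _ => ?_)
          rw [abs_mul, abs_of_nonneg (Set.indicator_nonneg (fun _ _ => zero_le_one) α)]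
      _ = ∑ α ∈ support x, |x α| *
            ∑ S ∈ F, S.1.nodes.indicator (fun _ => (1 : ℝ)) α := by
          rw [Finset.sum_comm]
          simp only [Finset.mul_sum]
      _ ≤ l1 x := by
          refine Finset.sum_le_sum fun α _ => ?_
          refine mul_le_of_le_one_right (abs_nonneg _) ?_
          by_cases hα : ∃ S ∈ F, α ∈ S.1.nodes
          · obtain ⟨S, hS, hαS⟩ := hα
            rw [Finset.sum_eq_single_of_mem S hS]
            · simp [hαS]
            · intro S' _ hne
              refine Set.indicator_of_notMem (fun h => ?_) _
              exact Set.disjoint_left.1 (hP S'.2 S.2 fun h => hne (Subtype.ext h)) h hαS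
          · rw [Finset.sum_eq_zero]
            · exact zero_le_one
            · intro S hS
              exact Set.indicator_of_notMem (fun h => hα ⟨S, hS, h⟩) _
  calc ∑ S ∈ F, (segSum S x) ^ 2 = ∑ S ∈ F, |segSum S x| ^ 2 := by simp only [sq_abs]
    _ ≤ (∑ S ∈ F, |segSum S x|) ^ 2 :=
        Finset.sum_sq_le_sq_sum_of_nonneg fun _ _ => abs_nonneg _
    _ ≤ l1 x ^ 2 := pow_le_pow_left₀ (Finset.sum_nonneg fun _ _ => abs_nonneg _) h1 2

theorem summable_sq {P : Set Segment} (hP : IsPartition P) (x : C00) :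
    Summable fun S : P => (segSum S x) ^ 2 :=
  summable_of_sum_le (fun _ => sq_nonneg _) (sum_sq_le hP x)

theorem partValue_nonneg (P : Set Segment) (x : C00) : 0 ≤ partValue P x := Real.sqrt_nonneg _

theorem partValue_le_l1 {P : Set Segment} (hP : IsPartition P) (x : C00) :
    partValue P x ≤ l1 x := by
  refine Real.sqrt_le_iff.2 ⟨l1_nonneg x, ?_⟩
  exact (summable_sq hP x).tsum_le_of_sum_le (sum_sq_le hP x)

theorem partValue_smul (P : Set Segment) (c : ℝ) (x : C00) :
    partValue P (c • x) = |c| * partValue P x := by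
  unfold partValue
  simp only [map_smul, smul_eq_mul, mul_pow, tsum_mul_left]
  rw [Real.sqrt_mul (sq_nonneg c), Real.sqrt_sq_eq_abs]

theorem partValue_add_le {P : Set Segment} (hP : IsPartition P) (x y : C00) :
    partValue P (x + y) ≤ partValue P x + partValue P y := by
  have e (z : C00) : partValue P z = (∑' S : P, |segSum S z| ^ (2 : ℝ)) ^ (1 / (2 : ℝ)) := by
    unfold partValue
    rw [Real.sqrt_eq_rpow]
    simp only [Real.rpow_two, sq_abs]
  have s (z : C00) : Summable fun S : P => |segSum S z| ^ (2 : ℝ) := by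
    simpa only [Real.rpow_two, sq_abs] using summable_sq hP z
  have key := Real.Lp_add_le_tsum_of_nonneg (p := 2) one_le_two
    (fun S : P => abs_nonneg (segSum S x)) (fun S : P => abs_nonneg (segSum S y)) (s x) (s y)
  rw [e (x + y), e x, e y]
  refine le_trans ?_ key.2
  refine Real.rpow_le_rpow (tsum_nonneg fun _ => by positivity) ?_ (by norm_num)
  refine (s (x + y)).tsum_le_tsum (fun S => ?_) key.1
  rw [map_add]
  exact Real.rpow_le_rpow (abs_nonneg _) (abs_add_le _ _) (by norm_num)

theorem bddAbove_partValue (x : C00) :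
    BddAbove (Set.range fun P : {P : Set Segment // IsPartition P} => partValue P.1 x) :=
  ⟨l1 x, by rintro _ ⟨P, rfl⟩; exact partValue_le_l1 P.2 x⟩

theorem partValue_le_jtNorm {P : Set Segment} (hP : IsPartition P) (x : C00) :
    partValue P x ≤ jtNorm x :=
  le_ciSup (bddAbove_partValue x) ⟨P, hP⟩

theorem isPartition_singleton (S : Segment) : IsPartition {S} :=
  Set.pairwiseDisjoint_singleton S _

instance : Nonempty {P : Set Segment // IsPartition P} :=
  ⟨⟨{Segment.single []}, isPartition_singleton _⟩⟩

theorem abs_segSum_le (S : Segment) (x : C00) : |segSum S x| ≤ jtNorm x := by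
  have h := partValue_le_jtNorm (isPartition_singleton S) x
  unfold partValue at h
  rwa [tsum_singleton S (fun T => (segSum T x) ^ 2), Real.sqrt_sq_eq_abs] at h

theorem jtNorm_nonneg (x : C00) : 0 ≤ jtNorm x := (abs_nonneg _).trans
  (abs_segSum_le (Segment.single []) x)

theorem segSum_single (α : Tree) (x : C00) :
    segSum (Segment.single α) x = x α := by
  classical
  rw [segSum_apply]
  simp only [Segment.single, Segment.nodes, Set.indicator_apply, Set.mem_singleton_iff, mul_ite,
    mul_one, mul_zero, Finset.sum_ite_eq']
  split_ifs with h
  · rfl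
  · exact (Finsupp.notMem_support_iff.1 h).symm

theorem jtNorm_smul (c : ℝ) (x : C00) : jtNorm (c • x) = |c| * jtNorm x := by
  unfold jtNorm
  simp only [partValue_smul]
  rw [Real.mul_iSup_of_nonneg (abs_nonneg c)]

theorem jtNorm_add_le (x y : C00) : jtNorm (x + y) ≤ jtNorm x + jtNorm y :=
  ciSup_le fun P => (partValue_add_le P.2 x y).trans
    (add_le_add (partValue_le_jtNorm P.2 x) (partValue_le_jtNorm P.2 y))

theorem eq_zero_of_jtNorm (x : C00) (h : jtNorm x = 0) : x = 0 := by
  refine Finsupp.ext (M := ℝ) fun α => ?_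
  have := abs_segSum_le (Segment.single α) x
  rw [h, segSum_single] at this
  exact abs_nonpos_iff.1 this

instance : Norm C00 := ⟨jtNorm⟩

theorem core : NormedSpace.Core ℝ C00 where
  norm_nonneg := jtNorm_nonneg
  norm_smul := jtNorm_smul
  norm_triangle := jtNorm_add_le
  norm_eq_zero_iff x := ⟨eq_zero_of_jtNorm x, by
    rintro rfl
    have := jtNorm_smul 0 0
    rwa [zero_smul, abs_zero, zero_mul] at this⟩

instance : NormedAddCommGroup C00 := NormedAddCommGroup.ofCore core
instance : NormedSpace ℝ C00 := NormedSpace.ofCore core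

/-- Summation over a segment as a continuous functional for the James tree norm. -/
def segSumL (S : Segment) : C00 →L[ℝ] ℝ :=
  (segSum S).mkContinuous 1 fun x => by
    rw [one_mul]
    exact abs_segSum_le S x

end C00

/-- The James tree space: the completion of `c₀₀` under the James tree norm. -/
abbrev JT : Type := UniformSpace.Completion C00

namespace JT

/-- The sum `∑_{α ∈ S} x(α)` of `x ∈ JT` over a segment `S`: the continuous extension to `JT` of
summation over `S` on `c₀₀`.  For an infinite segment this is the sum of the series of the
coordinates along `S` in increasing order, which may fail to converge absolutely
(see `tendsto_segSum`). -/
def segSum (S : Segment) : JT →L[ℝ] ℝ :=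
  (C00.segSumL S).extend UniformSpace.Completion.toComplL

/-- The coordinate `x(α)`. -/
def coord (x : JT) (α : Tree) : ℝ := segSum (Segment.single α) x

theorem segSum_coe (S : Segment) (x : C00) : segSum S (x : JT) = C00.segSum S x :=
  ContinuousLinearMap.extend_eq _ UniformSpace.Completion.denseRange_coe
    (UniformSpace.Completion.isUniformInducing_coe C00) x

theorem coord_coe (x : C00) (α : Tree) : coord (x : JT) α = x α := by
  rw [coord, segSum_coe, C00.segSum_single]

theorem abs_segSum_le (S : Segment) (x : JT) : |segSum S x| ≤ ‖x‖ := by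
  induction x using UniformSpace.Completion.induction_on with
  | hp => exact isClosed_le (segSum S).continuous.abs continuous_norm
  | ih x =>
    rw [segSum_coe, UniformSpace.Completion.norm_coe]
    exact C00.abs_segSum_le S x

theorem trunc_finite (S : Segment) (n : ℕ) :
    {α : Tree | α ∈ S.nodes ∧ List.length (α : List Bool) < n}.Finite :=
  (List.finite_length_lt Bool n).subset fun _ h => h.2

/-- The part of a segment below level `n`. -/
def trunc (S : Segment) (n : ℕ) : Segment :=
  ⟨{α : Tree | α ∈ S.nodes ∧ List.length (α : List Bool) < n},
    ⟨⟨fun _ ha _ hb _ hc => ⟨S.2.1.out ha.1 hb.1 hc,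
      lt_of_le_of_lt (List.IsPrefix.length_le hc.2) hb.2⟩⟩,
      S.2.2.mono fun _ h => h.1⟩⟩

theorem mem_trunc (S : Segment) (n : ℕ) (α : Tree) :
    α ∈ (trunc S n).nodes ↔ α ∈ S.nodes ∧ List.length (α : List Bool) < n :=
  Iff.rfl

theorem segSum_trunc (S : Segment) (n : ℕ) (x : JT) :
    segSum (trunc S n) x = ∑ α ∈ (trunc_finite S n).toFinset, coord x α := by
  classical
  induction x using UniformSpace.Completion.induction_on with
  | hp =>
    exact isClosed_eq (segSum _).continuous
      (continuous_finsetSum _ fun α _ => (segSum (Segment.single α)).continuous)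
  | ih x =>
    rw [segSum_coe, C00.segSum_apply]
    simp only [coord_coe, Set.indicator_apply, mul_ite, mul_one, mul_zero]
    rw [← Finset.sum_filter]
    refine Finset.sum_subset_zero_on_sdiff (fun α h => ?_) (fun α h => ?_) fun _ _ => rfl
    · rw [Set.Finite.mem_toFinset]
      exact (mem_trunc S n α).1 (Finset.mem_filter.1 h).2
    · rw [Finset.mem_sdiff, Set.Finite.mem_toFinset, Finset.mem_filter] at h
      exact Finsupp.notMem_support_iff.1 fun h' => h.2 ⟨h', (mem_trunc S n α).2 h.1⟩

/-- The segment sum is the limit of the finite partial sums of coordinates along the segment. -/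
theorem tendsto_segSum (S : Segment) (x : JT) :
    Filter.Tendsto (fun n => ∑ α ∈ (trunc_finite S n).toFinset, coord x α) Filter.atTop
      (nhds (segSum S x)) := by
  classical
  simp only [← segSum_trunc]
  rw [Metric.tendsto_atTop]
  intro ε hε
  obtain ⟨y, hy⟩ := UniformSpace.Completion.denseRange_coe.exists_dist_lt x (half_pos hε)
  refine ⟨(C00.support y).sup (fun α => List.length (α : List Bool)) + 1, fun n hn => ?_⟩
  have e : segSum (trunc S n) (y : JT) = segSum S (y : JT) := by
    rw [segSum_coe, segSum_coe, C00.segSum_apply, C00.segSum_apply]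
    refine Finset.sum_congr rfl fun α hα => ?_
    have h : List.length (α : List Bool) < n :=
      lt_of_lt_of_le (Nat.lt_succ_of_le
        (Finset.le_sup (f := fun α : Tree => List.length (α : List Bool)) hα)) hn
    congr 1
    simp only [Set.indicator_apply, mem_trunc, h, and_true]
  rw [dist_eq_norm] at hy ⊢
  have h1 := abs_segSum_le (trunc S n) (x - y)
  have h2 := abs_segSum_le S (x - y)
  rw [map_sub] at h1 h2
  rw [e] at h1
  rw [Real.norm_eq_abs]
  rw [abs_le] at h1 h2
  rw [abs_lt]
  constructor <;> linarith [h1.1, h1.2, h2.1, h2.2]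

/-- The support of `x`. -/
def supp (x : JT) : Set Tree := {α | coord x α ≠ 0}

/-- The range of `x`: the smallest complete (that is, order convex) subset of the tree that
contains the support. -/
def ran (x : JT) : Set Tree := ⋂₀ {K : Set Tree | K.OrdConnected ∧ supp x ⊆ K}

/-- The value `(∑_{S ∈ P} (∑_{α ∈ S} x(α))²)^{1/2}` of `x` at the family `P`. -/
def partValue (P : Set Segment) (x : JT) : ℝ :=
  Real.sqrt (∑' S : P, (segSum S x) ^ 2)

/-- A norming partition of `x`: a partition at which the norm is attained. -/
def IsNorming (x : JT) (P : Set Segment) : Prop :=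
  IsPartition P ∧ ‖x‖ = partValue P x

/-- `x` is separated if any two distinct nodes of its range belong to different segments of some
norming partition of `x`. -/
def IsSeparated (x : JT) : Prop :=
  ∀ α ∈ ran x, ∀ β ∈ ran x, α ≠ β →
    ∃ P, IsNorming x P ∧ ∃ S ∈ P, ∃ S' ∈ P, S ≠ S' ∧ α ∈ S.nodes ∧ β ∈ S'.nodes

/-- `‖x‖_JT = ‖x‖_2`: the coordinates are square summable and the norms agree. -/
def NormEqL2 (x : JT) : Prop :=
  (Summable fun α => (coord x α) ^ 2) ∧ ‖x‖ = Real.sqrt (∑' α, (coord x α) ^ 2)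

/-- A non-zero `x` is an extreme point (of the ball of radius `‖x‖`) if it is not a non-trivial
convex combination of two vectors of the same norm. -/
def IsExtreme (x : JT) : Prop :=
  x ≠ 0 ∧ ∀ (y z : JT) (t : ℝ), 0 < t → t < 1 → ‖y‖ = ‖x‖ → ‖z‖ = ‖x‖ →
    x = t • y + (1 - t) • z → x = y ∧ y = z

end JT

end JamesTree

end

noncomputable section

namespace JamesTree

open Filter Topology

/-! Write R for `ran x` and E(D) for `energy x D`, the squared norm of x restricted to D. E is
monotone, superadditive on disjoint sets, and E(R) = ‖x‖². The inequality ‖x‖_2 ≤ ‖x‖ comes from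
partitions into singletons, so the task is ‖x‖² ≤ ∑ x(α)².

The support hypotheses serve only to make R a chain forest: nodes of R above a common node of R are
comparable. Fix α in R. Separating α from its successor and from its predecessor in R gives two
segments A and B that belong to norming partitions, A with last node α and B with first node α. Let
u, v, w be the sums of x over A \ {α}, {α}, B \ {α}. Comparing the two norming values with the
competitors that use {α} or A ∪ B forces uv ≥ 0, wv ≥ 0 and uw ≤ 0, so uv = 0 or wv = 0. Then the
segment in question can be cut at α without loss (`crossing_le`), and ‖x‖² ≤ x(α)² + E(R below α) +
E(rest of R) (`IsSeparated.norm_sq_le_at`).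

This lets a maximal node be peeled off any finite down-closed subset G of R, so E(G) ≤ ∑_{α ∈ G}
x(α)² by induction. Truncating segments by height gives the bound on ‖x‖². Extremality then follows
from the strict convexity of ℓ₂, since ‖·‖_2 ≤ ‖·‖ on all of JT. -/

theorem isSegment_empty : IsSegment ∅ :=
  ⟨Set.ordConnected_empty, IsChain.empty⟩

theorem IsSegment.inter {A R : Set Tree} (hA : IsSegment A) (hR : R.OrdConnected) :
    IsSegment (A ∩ R) :=
  ⟨hA.1.inter hR, hA.2.mono Set.inter_subset_left⟩

/-- Initial segments of the same node are comparable. -/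
theorem le_total_of_le {α β γ : Tree} (hα : α ≤ γ) (hβ : β ≤ γ) : α ≤ β ∨ β ≤ α :=
  List.prefix_or_prefix_of_prefix hα hβ

theorem IsSegment.le_total {A : Set Tree} (hA : IsSegment A) {α β : Tree} (hα : α ∈ A)
    (hβ : β ∈ A) : α ≤ β ∨ β ≤ α :=
  hA.2.total hα hβ

theorem Segment.isSegment (S : Segment) : IsSegment S.nodes := S.2

open Classical in
/-- The segment with node set `A`; the empty segment if `A` is not a segment. -/
def Segment.ofSet (A : Set Tree) : Segment :=
  if h : IsSegment A then ⟨A, h⟩ else ⟨∅, isSegment_empty⟩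

theorem Segment.nodes_ofSet {A : Set Tree} (hA : IsSegment A) :
    (Segment.ofSet A).nodes = A := by
  simp [Segment.ofSet, hA, Segment.nodes]

theorem Segment.ofSet_nodes (S : Segment) : Segment.ofSet S.nodes = S := by
  have h : IsSegment S.nodes := S.2
  simp [Segment.ofSet, h]
  rfl

/-! ### Reduction of the norm to finite partitions -/

namespace C00

theorem segSum_eq_zero_of_nodes_eq_empty {S : Segment} (hS : S.nodes = ∅) (x : C00) :
    segSum S x = 0 := by
  simp [segSum_apply, hS]

theorem sum_segSum_sq_le {F : Finset Segment}
    (hF : IsPartition (F : Set Segment)) (x : C00) :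
    ∑ S ∈ F, (segSum S x) ^ 2 ≤ jtNorm x ^ 2 := by
  have h := partValue_le_jtNorm hF x
  unfold partValue at h
  rw [Finset.tsum_subtype' F (fun S => (segSum S x) ^ 2)] at h
  exact (Real.sqrt_le_left (jtNorm_nonneg x)).1 h

theorem exists_finset_lt {x : C00} {r : ℝ} (hr : r < jtNorm x) :
    ∃ F : Finset Segment, IsPartition (F : Set Segment) ∧
      r < Real.sqrt (∑ S ∈ F, (segSum S x) ^ 2) := by
  obtain ⟨⟨P, hP⟩, h⟩ := exists_lt_of_lt_ciSup hr
  have hlim := (Real.continuous_sqrt.tendsto _).comp (summable_sq hP x).hasSum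
  obtain ⟨F, hF⟩ := (hlim.eventually (lt_mem_nhds h)).exists
  refine ⟨F.map (Function.Embedding.subtype _), ?_, ?_⟩
  · refine hP.subset ?_
    intro S hS
    simp only [Finset.coe_map, Set.mem_image] at hS
    obtain ⟨T, _, rfl⟩ := hS
    exact T.2
  · simpa using hF

end C00

namespace JT

theorem segSum_eq_zero_of_nodes_eq_empty {S : Segment} (hS : S.nodes = ∅) (x : JT) :
    segSum S x = 0 := by
  induction x using UniformSpace.Completion.induction_on with
  | hp => exact isClosed_eq (segSum S).continuous continuous_const
  | ih x => rw [segSum_coe, C00.segSum_eq_zero_of_nodes_eq_empty hS]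

/-- For a finite partition both sides are continuous in x, so the inequality passes from c₀₀ to the
completion. -/
theorem sum_segSum_sq_le {F : Finset Segment} (hF : IsPartition (F : Set Segment)) (x : JT) :
    ∑ S ∈ F, (segSum S x) ^ 2 ≤ ‖x‖ ^ 2 := by
  induction x using UniformSpace.Completion.induction_on with
  | hp =>
    exact isClosed_le (continuous_finsetSum _ fun S _ => (segSum S).continuous.pow 2)
      (continuous_norm.pow 2)
  | ih x =>
    simp only [segSum_coe, UniformSpace.Completion.norm_coe]
    exact C00.sum_segSum_sq_le hF x

theorem sqrt_sum_sq_add_le {ι : Type*} (s : Finset ι) (f g : ι → ℝ) :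
    Real.sqrt (∑ i ∈ s, (f i + g i) ^ 2) ≤
      Real.sqrt (∑ i ∈ s, f i ^ 2) + Real.sqrt (∑ i ∈ s, g i ^ 2) := by
  have h := Real.Lp_add_le s f g (p := 2) one_le_two
  simpa only [Real.rpow_two, sq_abs, ← Real.sqrt_eq_rpow] using h

theorem exists_finset_lt {x : JT} {r : ℝ} (hr : r < ‖x‖) :
    ∃ F : Finset Segment, IsPartition (F : Set Segment) ∧
      r < Real.sqrt (∑ S ∈ F, (segSum S x) ^ 2) := by
  obtain ⟨y, hy⟩ := UniformSpace.Completion.denseRange_coe.exists_dist_lt x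
    (half_pos (sub_pos.2 hr))
  rw [dist_eq_norm] at hy
  -- Half of the gap between r and ‖x‖ is spent on replacing x by y, the other half on returning
  -- from y to x.
  have hy' : (r + ‖x‖) / 2 < C00.jtNorm y := by
    have h1 : ‖x‖ ≤ ‖x - (y : JT)‖ + ‖(y : JT)‖ := by
      simpa using norm_add_le (x - (y : JT)) y
    have h2 : ‖(y : JT)‖ = C00.jtNorm y := UniformSpace.Completion.norm_coe y
    linarith
  obtain ⟨F, hF, h⟩ := C00.exists_finset_lt hy'
  refine ⟨F, hF, ?_⟩
  have h1 := sqrt_sum_sq_add_le F (fun S => segSum S x) (fun S => segSum S ((y : JT) - x))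
  have h2 : Real.sqrt (∑ S ∈ F, (segSum S ((y : JT) - x)) ^ 2) ≤ ‖x - (y : JT)‖ := by
    rw [norm_sub_rev]
    exact Real.sqrt_le_iff.2 ⟨norm_nonneg _, sum_segSum_sq_le hF _⟩
  simp only [← map_add, add_sub_cancel, segSum_coe] at h1
  linarith

/-! ### Segment sums indexed by sets of nodes -/

/-- The sum of the coordinates of `x` over the segment `A`; zero if `A` is not a segment. -/
def segVal (x : JT) (A : Set Tree) : ℝ := segSum (Segment.ofSet A) x

theorem segVal_nodes (x : JT) (S : Segment) : segVal x S.nodes = segSum S x := by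
  rw [segVal, Segment.ofSet_nodes]

theorem segVal_singleton (x : JT) (α : Tree) : segVal x {α} = coord x α :=
  segVal_nodes x (Segment.single α)

theorem segVal_empty (x : JT) : segVal x ∅ = 0 :=
  segSum_eq_zero_of_nodes_eq_empty (Segment.nodes_ofSet isSegment_empty) x

theorem segVal_union (x : JT) {A B : Set Tree} (hA : IsSegment A) (hB : IsSegment B)
    (hAB : IsSegment (A ∪ B)) (hd : Disjoint A B) :
    segVal x (A ∪ B) = segVal x A + segVal x B := by
  unfold segVal
  induction x using UniformSpace.Completion.induction_on with
  | hp =>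
    exact isClosed_eq (segSum _).continuous ((segSum _).continuous.add (segSum _).continuous)
  | ih x =>
    simp only [segSum_coe, C00.segSum_apply, Segment.nodes_ofSet hA, Segment.nodes_ofSet hB,
      Segment.nodes_ofSet hAB, Set.indicator_union_of_disjoint hd, mul_add,
      Finset.sum_add_distrib]

/-- Each segment sum is the limit of its finite coordinate sums (`tendsto_segSum`), so it depends
only on the coordinates inside the segment. -/
theorem segSum_congr {x y : JT} {S T : Segment}
    (h : ∀ α, S.nodes.indicator (coord x) α = T.nodes.indicator (coord y) α) :
    segSum S x = segSum T y := by
  classical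
  refine tendsto_nhds_unique (tendsto_segSum S x) ((tendsto_segSum T y).congr fun n => ?_)
  have hn : {α : Tree | List.length (α : List Bool) < n}.Finite := List.finite_length_lt Bool n
  have key : ∀ (S : Segment) (x : JT), ∑ α ∈ (trunc_finite S n).toFinset, coord x α =
      ∑ α ∈ hn.toFinset, S.nodes.indicator (coord x) α := by
    intro S x
    simp only [Set.indicator_apply]
    rw [← Finset.sum_filter]
    refine Finset.sum_congr (Finset.ext fun α => ?_) fun _ _ => rfl
    rw [Set.Finite.mem_toFinset, Finset.mem_filter, Set.Finite.mem_toFinset]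
    exact and_comm
  rw [key, key]
  exact (Finset.sum_congr rfl fun α _ => h α).symm

theorem segVal_inter (x : JT) {A R : Set Tree} (hA : IsSegment A) (hR : R.OrdConnected)
    (hx : supp x ⊆ R) : segVal x (A ∩ R) = segVal x A := by
  classical
  refine segSum_congr fun α => ?_
  rw [Segment.nodes_ofSet hA, Segment.nodes_ofSet (hA.inter hR)]
  by_cases hα : α ∈ R
  · simp [Set.indicator_apply, hα]
  · have : coord x α = 0 := by
      by_contra h
      exact hα (hx h)
    simp [Set.indicator_apply, this]

/-! ### Energy of a set of nodes -/

/-- A finite family of pairwise disjoint segments inside `D`. -/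
def IsFamily (D : Set Tree) (F : Finset (Set Tree)) : Prop :=
  (∀ A ∈ F, IsSegment A ∧ A ⊆ D) ∧ (F : Set (Set Tree)).PairwiseDisjoint id

theorem isFamily_empty (D : Set Tree) : IsFamily D ∅ := by
  simp [IsFamily]

theorem IsFamily.subset {D : Set Tree} {F G : Finset (Set Tree)} (hF : IsFamily D F)
    (h : G ⊆ F) : IsFamily D G :=
  ⟨fun A hA => hF.1 A (h hA), hF.2.subset (Finset.coe_subset.2 h)⟩

instance (D : Set Tree) : Nonempty {F : Finset (Set Tree) // IsFamily D F} :=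
  ⟨⟨∅, isFamily_empty D⟩⟩

/-- The square of the James tree norm of the restriction of `x` to `D`. -/
def energy (x : JT) (D : Set Tree) : ℝ :=
  ⨆ F : {F : Finset (Set Tree) // IsFamily D F}, ∑ A ∈ F.1, segVal x A ^ 2

/-- Disjoint sets with different indices can coincide only if they are empty, and the empty segment
contributes nothing. -/
theorem sum_image_segVal {ι : Type*} [DecidableEq (Set Tree)] (x : JT) (s : Finset ι)
    (T : ι → Set Tree) (hd : (s : Set ι).PairwiseDisjoint T) :
    ∑ A ∈ s.image T, segVal x A ^ 2 = ∑ i ∈ s, segVal x (T i) ^ 2 := by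
  refine Finset.sum_image_of_pairwise_eq_zero fun i hi j hj hij h => ?_
  have h' := hd hi hj hij
  simp only [Function.onFun, ← h, disjoint_self] at h'
  rw [h', Set.bot_eq_empty, segVal_empty, zero_pow two_ne_zero]

theorem sum_segVal_sq_le {D : Set Tree} {F : Finset (Set Tree)} (hF : IsFamily D F) (x : JT) :
    ∑ A ∈ F, segVal x A ^ 2 ≤ ‖x‖ ^ 2 := by
  classical
  have hinj : Set.InjOn Segment.ofSet (F : Set (Set Tree)) := by
    intro A hA B hB h
    rw [← Segment.nodes_ofSet (hF.1 A hA).1, h, Segment.nodes_ofSet (hF.1 B hB).1]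
  have h := sum_segSum_sq_le (F := F.image Segment.ofSet) ?_ x
  · rwa [Finset.sum_image hinj] at h
  · rw [IsPartition, Finset.coe_image, hinj.pairwiseDisjoint_image]
    intro A hA B hB hAB
    simp only [Function.onFun, Function.comp, Segment.nodes_ofSet (hF.1 A hA).1,
      Segment.nodes_ofSet (hF.1 B hB).1]
    exact hF.2 hA hB hAB

theorem bddAbove_energy (x : JT) (D : Set Tree) :
    BddAbove (Set.range fun F : {F : Finset (Set Tree) // IsFamily D F} =>
      ∑ A ∈ F.1, segVal x A ^ 2) :=
  ⟨‖x‖ ^ 2, by rintro _ ⟨F, rfl⟩; exact sum_segVal_sq_le F.2 x⟩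

theorem IsFamily.sum_le {D : Set Tree} {F : Finset (Set Tree)} (hF : IsFamily D F) (x : JT) :
    ∑ A ∈ F, segVal x A ^ 2 ≤ energy x D :=
  le_ciSup (bddAbove_energy x D) ⟨F, hF⟩

theorem energy_le {x : JT} {D : Set Tree} {c : ℝ}
    (h : ∀ F, IsFamily D F → ∑ A ∈ F, segVal x A ^ 2 ≤ c) : energy x D ≤ c :=
  ciSup_le fun F => h F.1 F.2

/-- The lower bound for the energy given by an indexed family of disjoint segments. -/
theorem sum_le_energy {ι : Type*} (x : JT) {D : Set Tree} (s : Finset ι) (T : ι → Set Tree)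
    (hT : ∀ i ∈ s, IsSegment (T i) ∧ T i ⊆ D) (hd : (s : Set ι).PairwiseDisjoint T) :
    ∑ i ∈ s, segVal x (T i) ^ 2 ≤ energy x D := by
  classical
  rw [← sum_image_segVal x s T hd]
  refine IsFamily.sum_le ⟨fun A hA => ?_, ?_⟩ x
  · obtain ⟨i, hi, rfl⟩ := Finset.mem_image.1 hA
    exact hT i hi
  · rintro A hA B hB hAB
    rw [Finset.mem_coe, Finset.mem_image] at hA hB
    obtain ⟨i, hi, rfl⟩ := hA
    obtain ⟨j, hj, rfl⟩ := hB
    exact hd hi hj fun h => hAB (h ▸ rfl)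

theorem segVal_sq_le_energy (x : JT) {A D : Set Tree} (hA : IsSegment A) (h : A ⊆ D) :
    segVal x A ^ 2 ≤ energy x D := by
  simpa using sum_le_energy x {A} id (by simpa using ⟨hA, h⟩) (by simp)

theorem energy_mono (x : JT) {D E : Set Tree} (h : D ⊆ E) : energy x D ≤ energy x E :=
  energy_le fun _ hF => IsFamily.sum_le
    ⟨fun A hA => ⟨(hF.1 A hA).1, (hF.1 A hA).2.trans h⟩, hF.2⟩ x

theorem energy_le_norm_sq (x : JT) (D : Set Tree) : energy x D ≤ ‖x‖ ^ 2 :=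
  energy_le fun _ hF => sum_segVal_sq_le hF x

theorem energy_empty (x : JT) : energy x ∅ = 0 := by
  refine le_antisymm (energy_le fun F hF => ?_) ?_
  · refine (Finset.sum_eq_zero fun A hA => ?_).le
    rw [Set.subset_empty_iff.1 (hF.1 A hA).2, segVal_empty, zero_pow two_ne_zero]
  · simpa using (isFamily_empty ∅).sum_le x

/-- A family in D and a family in E together form a family in G; the only possible common member is
the empty segment. -/
theorem energy_add_le (x : JT) {D E G : Set Tree} (hd : Disjoint D E) (hD : D ⊆ G)
    (hE : E ⊆ G) : energy x D + energy x E ≤ energy x G := by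
  classical
  rw [← le_sub_iff_add_le]
  refine energy_le fun F hF => ?_
  rw [le_sub_comm]
  refine energy_le fun F' hF' => ?_
  rw [le_sub_iff_add_le, add_comm]
  have hdis : ∀ A ∈ F, ∀ B ∈ F', Disjoint A B := fun A hA B hB =>
    hd.mono (hF.1 A hA).2 (hF'.1 B hB).2
  rw [← Finset.sum_union_inter]
  have h0 : ∑ A ∈ F ∩ F', segVal x A ^ 2 = 0 := by
    refine Finset.sum_eq_zero fun A hA => ?_
    obtain ⟨h1, h2⟩ := Finset.mem_inter.1 hA
    have := hdis A h1 A h2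
    rw [disjoint_self] at this
    rw [this, Set.bot_eq_empty, segVal_empty, zero_pow two_ne_zero]
  rw [h0, add_zero]
  refine IsFamily.sum_le ⟨fun A hA => ?_, ?_⟩ x
  · rcases Finset.mem_union.1 hA with h | h
    · exact ⟨(hF.1 A h).1, (hF.1 A h).2.trans hD⟩
    · exact ⟨(hF'.1 A h).1, (hF'.1 A h).2.trans hE⟩
  · rw [Finset.coe_union, Set.pairwiseDisjoint_union]
    exact ⟨hF.2, hF'.2, fun A hA B hB _ => hdis A hA B hB⟩

theorem segVal_sq_add_energy_le (x : JT) {A D G : Set Tree} (hA : IsSegment A)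
    (hd : Disjoint A D) (hAG : A ⊆ G) (hD : D ⊆ G) :
    segVal x A ^ 2 + energy x D ≤ energy x G :=
  (add_le_add_left (segVal_sq_le_energy x hA subset_rfl) _).trans (energy_add_le x hd hAG hD)

/-- Subadditivity needs that no segment of G straddles D and E; the members of a family can then be
sorted between the two sets. -/
theorem energy_le_add (x : JT) {D E G : Set Tree}
    (h : ∀ A, IsSegment A → A ⊆ G → A ⊆ D ∨ A ⊆ E) :
    energy x G ≤ energy x D + energy x E := by
  classical
  refine energy_le fun F hF => ?_
  rw [← Finset.sum_filter_add_sum_filter_not F (fun A => A ⊆ D)]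
  refine add_le_add ?_ ?_
  · refine IsFamily.sum_le ⟨fun A hA => ?_, (hF.subset (Finset.filter_subset _ _)).2⟩ x
    rw [Finset.mem_filter] at hA
    exact ⟨(hF.1 A hA.1).1, hA.2⟩
  · refine IsFamily.sum_le ⟨fun A hA => ?_, (hF.subset (Finset.filter_subset _ _)).2⟩ x
    rw [Finset.mem_filter] at hA
    exact ⟨(hF.1 A hA.1).1, (h A (hF.1 A hA.1).1 (hF.1 A hA.1).2).resolve_left hA.2⟩

theorem sum_segVal_sq_le_energy_of_supp_subset (x : JT) {R : Set Tree} (hR : R.OrdConnected)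
    (hx : supp x ⊆ R) {D : Set Tree} {F : Finset Segment} (hF : IsPartition (F : Set Segment))
    (hD : ∀ S ∈ F, S.nodes ∩ R ⊆ D) :
    ∑ S ∈ F, (segSum S x) ^ 2 ≤ energy x D := by
  have h := sum_le_energy x F (fun S => S.nodes ∩ R)
    (fun S hS => ⟨S.isSegment.inter hR, hD S hS⟩)
    (fun S hS T hT hST => (hF hS hT hST).mono Set.inter_subset_left Set.inter_subset_left)
  refine le_trans (Finset.sum_le_sum fun S _ => ?_) h
  rw [segVal_inter x S.isSegment hR hx, segVal_nodes]

/-- Cutting a partition down to an order-convex set that contains the support leaves segments with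
the same sums. -/
theorem norm_sq_le_energy (x : JT) {R : Set Tree} (hR : R.OrdConnected)
    (hx : supp x ⊆ R) : ‖x‖ ^ 2 ≤ energy x R := by
  have h0 : 0 ≤ energy x R := by simpa using (isFamily_empty R).sum_le x
  rw [← Real.le_sqrt (norm_nonneg x) h0]
  refine le_of_forall_lt fun r hr => ?_
  obtain ⟨F, hF, h⟩ := exists_finset_lt hr
  exact h.trans_le (Real.sqrt_le_sqrt
    (sum_segVal_sq_le_energy_of_supp_subset x hR hx hF fun S _ => Set.inter_subset_right))

/-! ### Norming partitions -/

theorem IsNorming.summable {x : JT} {P : Set Segment} (hP : IsNorming x P) :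
    Summable fun S : P => (segSum S x) ^ 2 := by
  refine summable_of_sum_le (c := ‖x‖ ^ 2) (fun _ => sq_nonneg _) fun F => ?_
  have h := sum_segSum_sq_le (F := F.map (Function.Embedding.subtype _)) ?_ x
  · simpa using h
  · refine hP.1.subset ?_
    intro S hS
    simp only [Finset.coe_map, Set.mem_image] at hS
    obtain ⟨T, _, rfl⟩ := hS
    exact T.2

/-- A norming partition splits the energy along any of its members. -/
theorem IsNorming.norm_sq_le {x : JT} {P : Set Segment} (hP : IsNorming x P) {R : Set Tree}
    (hR : R.OrdConnected) (hx : supp x ⊆ R) {A : Segment} (hA : A ∈ P) :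
    ‖x‖ ^ 2 ≤ segVal x (A.nodes ∩ R) ^ 2 + energy x (R \ A.nodes) := by
  classical
  rw [segVal_inter x A.isSegment hR hx, segVal_nodes, hP.2, partValue,
    Real.sq_sqrt (tsum_nonneg fun _ => sq_nonneg _)]
  refine hP.summable.tsum_le_of_sum_le fun F => ?_
  -- Enlarging the finite subfamily so that it contains A lets the term of A be isolated; the other
  -- members avoid A by disjointness.
  refine (Finset.sum_le_sum_of_subset_of_nonneg (Finset.subset_insert ⟨A, hA⟩ F)
    fun _ _ _ => sq_nonneg _).trans ?_
  rw [← Finset.add_sum_erase _ _ (Finset.mem_insert_self ⟨A, hA⟩ F)]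
  refine add_le_add le_rfl ?_
  have h := sum_segVal_sq_le_energy_of_supp_subset x hR hx (D := R \ A.nodes)
    (F := ((insert ⟨A, hA⟩ F).erase ⟨A, hA⟩).map (Function.Embedding.subtype _)) ?_ ?_
  · rwa [Finset.sum_map] at h
  · refine hP.1.subset ?_
    intro S hS
    simp only [Finset.coe_map, Set.mem_image] at hS
    obtain ⟨T, _, rfl⟩ := hS
    exact T.2
  · intro S hS
    obtain ⟨T, hT, rfl⟩ := Finset.mem_map.1 hS
    have hne : (T : Segment) ≠ A := fun h => (Finset.mem_erase.1 hT).1 (Subtype.ext h)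
    exact fun α hα => ⟨hα.2, Set.disjoint_left.1 (hP.1 T.2 hA hne) hα.1⟩

end JT

/-! ### Heights and chain forests -/

/-- The length of a node. -/
def height (α : Tree) : ℕ := List.length (α : List Bool)

theorem height_mono {α β : Tree} (h : α ≤ β) : height α ≤ height β :=
  List.IsPrefix.length_le h

theorem eq_of_le_of_height_le {α β : Tree} (h : α ≤ β) (h' : height β ≤ height α) : α = β :=
  List.IsPrefix.eq_of_length_le h h'

theorem finite_height_lt (n : ℕ) : {α : Tree | height α < n}.Finite :=
  List.finite_length_lt Bool n

theorem finite_Iio (α : Tree) : (Set.Iio α).Finite :=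
  (finite_height_lt (height α)).subset fun _ h =>
    lt_of_not_ge fun h' => h.ne (eq_of_le_of_height_le h.le h')

/-- Two nodes of `R` above a common node of `R` are comparable. -/
def IsChainForest (R : Set Tree) : Prop :=
  ∀ α ∈ R, ∀ β ∈ R, ∀ γ ∈ R, γ ≤ α → γ ≤ β → α ≤ β ∨ β ≤ α

/-- A segment that avoids `α` lies strictly below `α` or has no node below `α`. -/
theorem IsChainForest.subset_or {R : Set Tree} (hR : IsChainForest R) {α : Tree} (hα : α ∈ R)
    {A : Set Tree} (hA : IsSegment A) (hAR : A ⊆ R) (h : α ∉ A) :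
    A ⊆ {β | β < α} ∨ A ⊆ {β | ¬ β ≤ α} := by
  by_cases h0 : ∃ β ∈ A, β ≤ α
  · left
    obtain ⟨β, hβ, hβα⟩ := h0
    intro γ hγ
    have hγα : γ ≠ α := fun e => h (e ▸ hγ)
    refine lt_of_le_of_ne ?_ hγα
    rcases hA.le_total hβ hγ with h1 | h1
    · rcases hR α hα γ (hAR hγ) β (hAR hβ) hβα h1 with h2 | h2
      · exact absurd (hA.1.out hβ hγ ⟨hβα, h2⟩) h
      · exact h2
    · exact h1.trans hβα
  · right
    intro β hβ hβα
    exact h0 ⟨β, hβ, hβα⟩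

/-! ### Splittings obtained from separation -/

namespace JT

/-- The energy of `x` splits along the segment `A` of the set `R`. -/
structure Splits (x : JT) (R A : Set Tree) : Prop where
  isSegment : IsSegment A
  subset : A ⊆ R
  norm_sq_le : ‖x‖ ^ 2 ≤ segVal x A ^ 2 + energy x (R \ A)

theorem ordConnected_ran (x : JT) : (ran x).OrdConnected :=
  Set.ordConnected_sInter fun _ h => h.1

theorem supp_subset_ran (x : JT) : supp x ⊆ ran x :=
  Set.subset_sInter fun _ h => h.2

theorem IsNorming.splits {x : JT} {P : Set Segment} (hP : IsNorming x P) {A : Segment}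
    (hA : A ∈ P) : Splits x (ran x) (A.nodes ∩ ran x) where
  isSegment := A.isSegment.inter (ordConnected_ran x)
  subset := Set.inter_subset_right
  norm_sq_le := by
    have h := hP.norm_sq_le (ordConnected_ran x) (supp_subset_ran x) hA
    rwa [Set.sdiff_inter_self_eq_sdiff]

theorem splits_singleton_of_subsingleton {x : JT} (h : (ran x).Subsingleton) {α : Tree}
    (hα : α ∈ ran x) : Splits x (ran x) {α} where
  isSegment := isSegment_singleton α
  subset := Set.singleton_subset_iff.2 hα
  norm_sq_le := by
    classical
    have hr : ran x = {α} := h.eq_singleton_of_mem hα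
    refine (norm_sq_le_energy x (ordConnected_ran x) (supp_subset_ran x)).trans ?_
    rw [hr, sdiff_self, Set.bot_eq_empty, energy_empty, add_zero]
    refine energy_le fun F hF => ?_
    have hsub : F ⊆ {∅, {α}} := fun A hA => by
      have := Set.subset_singleton_iff_eq.1 (hF.1 A hA).2
      simpa using this
    refine (Finset.sum_le_sum_of_subset_of_nonneg hsub fun _ _ _ => sq_nonneg _).trans ?_
    rw [Finset.sum_pair (Set.singleton_nonempty α).ne_empty.symm, segVal_empty]
    simp

theorem IsSeparated.exists_splits {x : JT} (hx : IsSeparated x) {α β : Tree} (hα : α ∈ ran x)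
    (hβ : β ∈ ran x) (h : α ≠ β) : ∃ A, Splits x (ran x) A ∧ α ∈ A ∧ β ∉ A := by
  obtain ⟨P, hP, S, hS, T, hT, hne, h1, h2⟩ := hx α hα β hβ h
  exact ⟨_, hP.splits hS, ⟨h1, hα⟩, fun h3 => Set.disjoint_left.1 (hP.1 hS hT hne) h3.1 h2⟩

/-- A segment through α that goes beyond α inside a chain forest must contain the successor of α in
the range, so separating α from that successor stops the segment at α. -/
theorem IsSeparated.exists_splits_Iic {x : JT} (hx : IsSeparated x)
    (hR : IsChainForest (ran x)) {α : Tree} (hα : α ∈ ran x) :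
    ∃ A, Splits x (ran x) A ∧ α ∈ A ∧ A ⊆ Set.Iic α := by
  by_cases h : ∃ β, β ∈ ran x ∧ α < β
  · obtain ⟨β, ⟨hβ, hαβ⟩, hmin⟩ := (measure height).wf.has_min {β | β ∈ ran x ∧ α < β} h
    obtain ⟨A, hA, hαA, hβA⟩ := hx.exists_splits hα hβ hαβ.ne
    refine ⟨A, hA, hαA, fun γ hγ => ?_⟩
    rcases hA.isSegment.le_total hγ hαA with h1 | h1
    · exact h1
    by_contra h2
    have h3 : α < γ := lt_of_le_not_ge h1 h2
    have h4 : height β ≤ height γ := not_lt.1 (hmin γ ⟨hA.subset hγ, h3⟩)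
    rcases hR γ (hA.subset hγ) β hβ α hα h1 hαβ.le with h5 | h5
    · exact hβA (eq_of_le_of_height_le h5 h4 ▸ hγ)
    · exact hβA (hA.isSegment.1.out hαA hγ ⟨hαβ.le, h5⟩)
  · have key : ∀ A, Splits x (ran x) A → α ∈ A → A ⊆ Set.Iic α := fun A hA hαA γ hγ => by
      rcases hA.isSegment.le_total hγ hαA with h1 | h1
      · exact h1
      by_contra h2
      exact h ⟨γ, hA.subset hγ, lt_of_le_not_ge h1 h2⟩
    -- Separation says nothing when the range is a single point, so that case is settled directly.
    by_cases hs : (ran x).Subsingleton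
    · exact ⟨{α}, splits_singleton_of_subsingleton hs hα, rfl, by simp⟩
    · obtain ⟨β, hβ, hne⟩ := (Set.not_subsingleton_iff.1 hs).exists_ne α
      obtain ⟨A, hA, hαA, -⟩ := hx.exists_splits hα hβ hne.symm
      exact ⟨A, hA, hαA, key A hA hαA⟩

/-- The dual argument with the predecessor of α. The nodes below α form a finite chain in any tree,
so no forest hypothesis is needed. -/
theorem IsSeparated.exists_splits_Ici {x : JT} (hx : IsSeparated x) {α : Tree}
    (hα : α ∈ ran x) : ∃ A, Splits x (ran x) A ∧ α ∈ A ∧ A ⊆ Set.Ici α := by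
  by_cases h : ∃ β, β ∈ ran x ∧ β < α
  · obtain ⟨β, ⟨hβ, hβα⟩, hmax⟩ := Set.exists_max_image {β | β ∈ ran x ∧ β < α} height
      ((finite_Iio α).subset fun _ h => h.2) h
    obtain ⟨A, hA, hαA, hβA⟩ := hx.exists_splits hα hβ hβα.ne'
    refine ⟨A, hA, hαA, fun γ hγ => ?_⟩
    rcases hA.isSegment.le_total hαA hγ with h1 | h1
    · exact h1
    by_contra h2
    have h3 : γ < α := lt_of_le_not_ge h1 h2
    have h4 : height γ ≤ height β := hmax γ ⟨hA.subset hγ, h3⟩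
    rcases le_total_of_le h1 hβα.le with h5 | h5
    · exact hβA (hA.isSegment.1.out hγ hαA ⟨h5, hβα.le⟩)
    · exact hβA ((eq_of_le_of_height_le h5 h4).symm ▸ hγ)
  · have key : ∀ A, Splits x (ran x) A → α ∈ A → A ⊆ Set.Ici α := fun A hA hαA γ hγ => by
      rcases hA.isSegment.le_total hαA hγ with h1 | h1
      · exact h1
      by_contra h2
      exact h ⟨γ, hA.subset hγ, lt_of_le_not_ge h1 h2⟩
    by_cases hs : (ran x).Subsingleton
    · exact ⟨{α}, splits_singleton_of_subsingleton hs hα, rfl, by simp⟩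
    · obtain ⟨β, hβ, hne⟩ := (Set.not_subsingleton_iff.1 hs).exists_ne α
      obtain ⟨A, hA, hαA, -⟩ := hx.exists_splits hα hβ hne.symm
      exact ⟨A, hA, hαA, key A hA hαA⟩

theorem isSegment_diff_max {A : Set Tree} {α : Tree} (hA : IsSegment A) (h : A ⊆ Set.Iic α) :
    IsSegment (A \ {α}) :=
  ⟨⟨fun _ hβ _ hγ _ hδ => ⟨hA.1.out hβ.1 hγ.1 hδ, fun e => hγ.2 (by
    rw [Set.mem_singleton_iff] at e ⊢
    exact le_antisymm (h hγ.1) (e ▸ hδ.2))⟩⟩, hA.2.mono Set.sdiff_subset⟩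

theorem isSegment_diff_min {A : Set Tree} {α : Tree} (hA : IsSegment A) (h : A ⊆ Set.Ici α) :
    IsSegment (A \ {α}) :=
  ⟨⟨fun _ hβ _ hγ _ hδ => ⟨hA.1.out hβ.1 hγ.1 hδ, fun e => hβ.2 (by
    rw [Set.mem_singleton_iff] at e ⊢
    exact le_antisymm (e ▸ hδ.1) (h hβ.1))⟩⟩, hA.2.mono Set.sdiff_subset⟩

theorem isSegment_union {A B : Set Tree} {α : Tree} (hA : IsSegment A) (hB : IsSegment B)
    (hαA : α ∈ A) (hαB : α ∈ B) (h : A ⊆ Set.Iic α) (h' : B ⊆ Set.Ici α) :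
    IsSegment (A ∪ B) := by
  refine ⟨⟨?_⟩, ?_⟩
  · rintro β hβ γ hγ δ ⟨h1, h2⟩
    rcases hβ with hβ | hβ <;> rcases hγ with hγ | hγ
    · exact Or.inl (hA.1.out hβ hγ ⟨h1, h2⟩)
    · rcases le_total_of_le h2 (h' hγ) with h3 | h3
      · exact Or.inl (hA.1.out hβ hαA ⟨h1, h3⟩)
      · exact Or.inr (hB.1.out hαB hγ ⟨h3, h2⟩)
    · exact Or.inl (hA.1.out hαA hγ ⟨(h' hβ).trans h1, h2⟩)
    · exact Or.inr (hB.1.out hβ hγ ⟨h1, h2⟩)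
  · rintro β hβ γ hγ -
    rcases hβ with hβ | hβ <;> rcases hγ with hγ | hγ
    · exact hA.le_total hβ hγ
    · exact Or.inl ((h hβ).trans (h' hγ))
    · exact Or.inr ((h hγ).trans (h' hβ))
    · exact hB.le_total hβ hγ

theorem segVal_eq_diff_add_coord (x : JT) {A : Set Tree} {α : Tree} (hA : IsSegment A)
    (hA' : IsSegment (A \ {α})) (hα : α ∈ A) :
    segVal x A = segVal x (A \ {α}) + coord x α := by
  have e : A \ {α} ∪ {α} = A := Set.sdiff_union_of_subset (Set.singleton_subset_iff.2 hα)
  have h := segVal_union x hA' (isSegment_singleton α) (by rwa [e]) Set.disjoint_sdiff_left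
  rwa [e, segVal_singleton] at h

/-! ### Cutting at a node -/

/-- Crossing two extremal splittings at their common node isolates that node. -/
theorem crossing_le {n u v w a b l m : ℝ} (h1 : n ≤ (u + v) ^ 2 + (a + m))
    (h2 : n ≤ (w + v) ^ 2 + (l + b)) (h3 : (u + (w + v)) ^ 2 + (a + b) ≤ n)
    (h4 : v ^ 2 + (l + m) ≤ n) (h5 : u ^ 2 + a ≤ l) (h6 : w ^ 2 + b ≤ m) :
    n ≤ v ^ 2 + (l + m) := by
  -- The first sign comes from `h1`, `h4`, `h5`, the second from `h2`, `h4`, `h6`. The third comes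
  -- from `h1 + h2` against `h3 + h4`, where all energies cancel and 2uw ≤ 0 remains.
  have huv : 0 ≤ u * v := by nlinarith
  have hwv : 0 ≤ w * v := by nlinarith
  have huw : u * w ≤ 0 := by nlinarith
  have hz : (u * v) * (w * v) ≤ 0 := by nlinarith [sq_nonneg v]
  -- If uv = 0 then (u + v)² = u² + v² and `h1`, `h5` conclude; if wv = 0, then `h2`, `h6` do.
  rcases mul_eq_zero.1 (le_antisymm hz (mul_nonneg huv hwv)) with h | h <;> nlinarith

theorem IsSeparated.norm_sq_le_at {x : JT} (hx : IsSeparated x)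
    (hR : IsChainForest (ran x)) {α : Tree} (hα : α ∈ ran x) :
    ‖x‖ ^ 2 ≤ coord x α ^ 2 +
      (energy x (ran x ∩ {β | β < α}) + energy x (ran x ∩ {β | ¬ β ≤ α})) := by
  obtain ⟨A, hA, hαA, hAα⟩ := hx.exists_splits_Iic hR hα
  obtain ⟨B, hB, hαB, hBα⟩ := hx.exists_splits_Ici hα
  have hA' := isSegment_diff_max hA.isSegment hAα
  have hB' := isSegment_diff_min hB.isSegment hBα
  have hAL : A \ {α} ⊆ ran x ∩ {β | β < α} := fun β hβ =>
    ⟨hA.subset hβ.1, lt_of_le_of_ne (hAα hβ.1) hβ.2⟩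
  have hBU : B \ {α} ⊆ ran x ∩ {β | ¬ β ≤ α} := fun β hβ =>
    ⟨hB.subset hβ.1, fun h => hβ.2 (le_antisymm h (hBα hβ.1))⟩
  have hLU : Disjoint (ran x ∩ {β | β < α}) (ran x ∩ {β | ¬ β ≤ α}) :=
    Set.disjoint_left.2 fun β h h' => h'.2 h.2.le
  -- A segment of the range that avoids C misses α, so by the forest property it lies on one side of
  -- α.
  have hsplit : ∀ C, α ∈ C → energy x (ran x \ C) ≤
      energy x ((ran x ∩ {β | β < α}) \ C) + energy x ((ran x ∩ {β | ¬ β ≤ α}) \ C) := by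
    intro C hαC
    refine energy_le_add x fun S hS hSC => ?_
    rcases hR.subset_or hα hS (fun β hβ => (hSC hβ).1) (fun h => (hSC h).2 hαC) with h | h
    · exact Or.inl fun β hβ => ⟨⟨(hSC hβ).1, h hβ⟩, (hSC hβ).2⟩
    · exact Or.inr fun β hβ => ⟨⟨(hSC hβ).1, h hβ⟩, (hSC hβ).2⟩
  have hsA := segVal_eq_diff_add_coord x hA.isSegment hA' hαA
  have hsB := segVal_eq_diff_add_coord x hB.isSegment hB' hαB
  have hAB : A ∪ B = A \ {α} ∪ B := by
    ext β
    by_cases h : β = α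
    · simp [h, hαB]
    · simp [h]
  have hABseg := isSegment_union hA.isSegment hB.isSegment hαA hαB hAα hBα
  have hsAB : segVal x (A ∪ B) = segVal x (A \ {α}) + segVal x B := by
    rw [hAB] at hABseg ⊢
    refine segVal_union x hA' hB.isSegment hABseg (Set.disjoint_left.2 fun β h h' => ?_)
    exact h.2 (le_antisymm (hAα h.1) (hBα h'))
  refine crossing_le (u := segVal x (A \ {α})) (w := segVal x (B \ {α}))
    (a := energy x ((ran x ∩ {β | β < α}) \ A)) (b := energy x ((ran x ∩ {β | ¬ β ≤ α}) \ B))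
    ?_ ?_ ?_ ?_ ?_ ?_
  · rw [← hsA]
    refine hA.norm_sq_le.trans (add_le_add le_rfl ((hsplit A hαA).trans
      (add_le_add le_rfl (energy_mono x Set.sdiff_subset))))
  · rw [← hsB]
    refine hB.norm_sq_le.trans (add_le_add le_rfl ((hsplit B hαB).trans
      (add_le_add (energy_mono x Set.sdiff_subset) le_rfl)))
  · rw [← hsB, ← hsAB]
    refine (add_le_add le_rfl (energy_add_le x (hLU.mono Set.sdiff_subset Set.sdiff_subset)
      Set.subset_union_left Set.subset_union_right)).trans
      ((segVal_sq_add_energy_le x (G := Set.univ) hABseg ?_ (Set.subset_univ _)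
        (Set.subset_univ _)).trans (energy_le_norm_sq x _))
    rw [Set.disjoint_left]
    rintro β (hβ | hβ) (h | h)
    · exact h.2 hβ
    · exact h.1.2 (hAα hβ)
    · exact (show β < α from h.1.2).not_ge (hBα hβ)
    · exact h.2 hβ
  · rw [← segVal_singleton]
    refine (add_le_add le_rfl (energy_add_le x hLU
      Set.subset_union_left Set.subset_union_right)).trans
      ((segVal_sq_add_energy_le x (G := Set.univ) (isSegment_singleton α) ?_ (Set.subset_univ _)
        (Set.subset_univ _)).trans (energy_le_norm_sq x _))
    rw [Set.disjoint_left]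
    rintro β rfl (h | h)
    · exact lt_irrefl β h.2
    · exact h.2 le_rfl
  · exact segVal_sq_add_energy_le x hA'
      (Set.disjoint_left.2 fun β h h' => h'.2 h.1) hAL Set.sdiff_subset
  · exact segVal_sq_add_energy_le x hB'
      (Set.disjoint_left.2 fun β h h' => h'.2 h.1) hBU Set.sdiff_subset

/-! ### Peeling off maximal nodes -/

/-- Removing a maximal node from a set closed downwards in the range. -/
theorem IsSeparated.energy_le_diff {x : JT} (hx : IsSeparated x)
    (hR : IsChainForest (ran x)) {G : Set Tree} (hG : G ⊆ ran x)
    (hdown : ∀ β ∈ ran x, ∀ γ ∈ G, β ≤ γ → β ∈ G) {α : Tree} (hα : α ∈ G)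
    (hmax : ∀ γ ∈ G, α ≤ γ → γ = α) :
    energy x G ≤ coord x α ^ 2 + energy x (G \ {α}) := by
  have h1 := hx.norm_sq_le_at hR (hG hα)
  -- Since α is maximal in G, a segment of G with a node below α cannot leave the set of nodes below
  -- α.
  have h2 : energy x G ≤ energy x (G ∩ {β | β ≤ α}) + energy x (G ∩ {β | ¬ β ≤ α}) := by
    refine energy_le_add x fun S hS hSG => ?_
    by_cases h : S ⊆ {β | β ≤ α}
    · exact Or.inl (Set.subset_inter hSG h)
    · refine Or.inr (Set.subset_inter hSG fun β hβ hβα => ?_)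
      obtain ⟨γ, hγ, hγα⟩ := Set.not_subset.1 h
      rcases hS.le_total hβ hγ with h3 | h3
      · rcases hR α (hG hα) γ (hG (hSG hγ)) β (hG (hSG hβ)) hβα h3 with h4 | h4
        · exact hγα (hmax γ (hSG hγ) h4).le
        · exact hγα h4
      · exact hγα (h3.trans hβα)
  -- With `h1`, the energy of the part of the range not below α cancels, which makes the global
  -- bound local to G.
  have h3 : energy x (G ∩ {β | β ≤ α}) + energy x (ran x ∩ {β | ¬ β ≤ α}) ≤ ‖x‖ ^ 2 :=
    (energy_add_le x (Set.disjoint_left.2 fun β h h' => h'.2 h.2) (Set.subset_univ _)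
      (Set.subset_univ _)).trans (energy_le_norm_sq x _)
  have h4 : energy x (ran x ∩ {β | β < α}) + energy x (G ∩ {β | ¬ β ≤ α}) ≤
      energy x (G \ {α}) := by
    refine energy_add_le x (Set.disjoint_left.2 fun β h h' => h'.2 h.2.le) ?_ ?_
    -- Down-closedness enters here: every node of the range below α already lies in G.
    · exact fun β h => ⟨hdown β h.1 α hα h.2.le, h.2.ne⟩
    · exact fun β h => ⟨h.1, fun e => h.2 (le_of_eq e)⟩
  linarith

theorem IsSeparated.energy_le_sum {x : JT} (hx : IsSeparated x)
    (hR : IsChainForest (ran x)) (G : Finset Tree) (hG : (G : Set Tree) ⊆ ran x)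
    (hdown : ∀ β ∈ ran x, ∀ γ ∈ G, β ≤ γ → β ∈ G) :
    energy x G ≤ ∑ α ∈ G, coord x α ^ 2 := by
  classical
  induction G using Finset.strongInduction with
  | H G ih =>
    rcases G.eq_empty_or_nonempty with rfl | hne
    · simp [energy_empty]
    · obtain ⟨α, hα, hmax⟩ := G.exists_max_image height hne
      have hmax' : ∀ γ ∈ G, α ≤ γ → γ = α := fun γ hγ h =>
        (eq_of_le_of_height_le h (hmax γ hγ)).symm
      refine (hx.energy_le_diff hR hG hdown hα hmax').trans ?_
      rw [← Finset.add_sum_erase _ _ hα, ← Finset.coe_erase]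
      refine add_le_add le_rfl (ih _ (Finset.erase_ssubset hα) ?_ ?_)
      · exact fun β h => hG (Finset.mem_of_mem_erase h)
      · intro β hβ γ hγ h
        rw [Finset.mem_erase] at hγ ⊢
        exact ⟨fun e => hγ.1 (hmax' γ hγ.2 (e ▸ h)), hdown β hβ γ hγ.2 h⟩

/-! ### Comparison with the ℓ₂ norm -/

theorem sum_coord_sq_le (x : JT) (G : Finset Tree) : ∑ α ∈ G, coord x α ^ 2 ≤ ‖x‖ ^ 2 := by
  refine le_trans ?_ (energy_le_norm_sq x Set.univ)
  simp only [← segVal_singleton]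
  exact sum_le_energy x G (fun α => {α}) (fun α _ => ⟨isSegment_singleton α, Set.subset_univ _⟩)
    fun α _ β _ h => Set.disjoint_singleton.2 h

theorem summable_coord_sq (x : JT) : Summable fun α => coord x α ^ 2 :=
  summable_of_sum_le (fun _ => sq_nonneg _) (sum_coord_sq_le x)

theorem tsum_coord_sq_le (x : JT) : ∑' α, coord x α ^ 2 ≤ ‖x‖ ^ 2 :=
  (summable_coord_sq x).tsum_le_of_sum_le (sum_coord_sq_le x)

theorem tendsto_segVal_trunc (x : JT) {A : Set Tree} (hA : IsSegment A) :
    Tendsto (fun n => segVal x (A ∩ {α | height α < n})) atTop (𝓝 (segVal x A)) := by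
  have h := tendsto_segSum (Segment.ofSet A) x
  simp only [← segSum_trunc] at h
  refine h.congr fun n => ?_
  rw [← segVal_nodes]
  congr 1
  ext α
  rw [mem_trunc, Segment.nodes_ofSet hA]
  rfl

/-- The nodes of the range below a given height form a finite down-closed subset of it, so
`IsSeparated.energy_le_sum` bounds each truncated family; segment sums are limits of their
truncations. -/
theorem IsSeparated.norm_sq_le_tsum {x : JT} (hx : IsSeparated x)
    (hR : IsChainForest (ran x)) : ‖x‖ ^ 2 ≤ ∑' α, coord x α ^ 2 := by
  classical
  refine (norm_sq_le_energy x (ordConnected_ran x) (supp_subset_ran x)).trans ?_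
  refine energy_le fun F hF => ?_
  have hlim : Tendsto (fun n => ∑ A ∈ F, segVal x (A ∩ {α | height α < n}) ^ 2) atTop
      (𝓝 (∑ A ∈ F, segVal x A ^ 2)) :=
    tendsto_finsetSum _ fun A hA => (tendsto_segVal_trunc x (hF.1 A hA).1).pow 2
  refine le_of_tendsto' hlim fun n => ?_
  have hc : {α : Tree | height α < n}.OrdConnected :=
    ⟨fun β _ γ hγ δ hδ => (height_mono hδ.2).trans_lt hγ⟩
  have hfin : (ran x ∩ {α | height α < n}).Finite :=
    (finite_height_lt n).subset Set.inter_subset_right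
  refine (sum_le_energy x (D := hfin.toFinset) F _ (fun A hA => ⟨(hF.1 A hA).1.inter hc, ?_⟩)
    fun A hA B hB h => (hF.2 hA hB h).mono Set.inter_subset_left Set.inter_subset_left).trans ?_
  · rw [hfin.coe_toFinset]
    exact Set.inter_subset_inter_left _ (hF.1 A hA).2
  · refine (hx.energy_le_sum hR _ (by simp) fun β hβ γ hγ h => ?_).trans
      ((summable_coord_sq x).sum_le_tsum _ fun _ _ => sq_nonneg _)
    rw [hfin.mem_toFinset] at hγ ⊢
    exact ⟨hβ, (height_mono h).trans_lt hγ.2⟩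

/-! ### Extremality -/

theorem eq_of_coord_eq {x y : JT} (h : ∀ α, coord x α = coord y α) : x = y := by
  rw [← sub_eq_zero, ← norm_eq_zero, ← sq_eq_zero_iff]
  refine le_antisymm ((norm_sq_le_energy (x - y) Set.ordConnected_univ
    (Set.subset_univ _)).trans (energy_le fun F _ => ?_)) (sq_nonneg _)
  refine (Finset.sum_eq_zero fun A _ => ?_).le
  have e : segSum (Segment.ofSet A) x = segSum (Segment.ofSet A) y := segSum_congr fun α => by
    simp only [Set.indicator, h]
  rw [segVal, map_sub, e, sub_self, zero_pow two_ne_zero]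

theorem NormEqL2.isExtreme {x : JT} (hx : NormEqL2 x) (h0 : x ≠ 0) : IsExtreme x := by
  refine ⟨h0, fun y z t ht0 ht1 hy hz h => ?_⟩
  have hN : ‖x‖ ^ 2 = ∑' α, coord x α ^ 2 := by
    rw [hx.2, Real.sq_sqrt (tsum_nonneg fun _ => sq_nonneg _)]
  have hco : ∀ α, coord x α = t * coord y α + (1 - t) * coord z α := fun α => by
    conv_lhs => rw [h]
    simp only [coord, map_add, map_smul, smul_eq_mul]
  have hs : HasSum (fun α => t * coord y α ^ 2 + (1 - t) * coord z α ^ 2 - coord x α ^ 2)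
      (t * ∑' α, coord y α ^ 2 + (1 - t) * ∑' α, coord z α ^ 2 - ∑' α, coord x α ^ 2) :=
    (((summable_coord_sq y).hasSum.mul_left t).add
      ((summable_coord_sq z).hasSum.mul_left (1 - t))).sub (summable_coord_sq x).hasSum
  -- The quantitative strict convexity of the square. Summed over the tree, the left side is at most
  -- t‖x‖² + (1 - t)‖x‖² - ‖x‖² = 0, so every coordinate of y - z vanishes.
  have hid : ∀ α, t * coord y α ^ 2 + (1 - t) * coord z α ^ 2 - coord x α ^ 2 =
      t * (1 - t) * (coord y α - coord z α) ^ 2 := fun α => by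
    rw [hco]
    ring
  simp only [hid] at hs
  have htt : 0 < t * (1 - t) := mul_pos ht0 (sub_pos.2 ht1)
  have hnn : ∀ α, 0 ≤ t * (1 - t) * (coord y α - coord z α) ^ 2 := fun α =>
    mul_nonneg htt.le (sq_nonneg _)
  have hy' := tsum_coord_sq_le y
  have hz' := tsum_coord_sq_le z
  rw [hy] at hy'
  rw [hz] at hz'
  have hyz : y = z := by
    refine eq_of_coord_eq fun α => ?_
    have h1 := le_hasSum hs α fun β _ => hnn β
    have h2 := mul_le_mul_of_nonneg_left hy' ht0.le
    have h3 := mul_le_mul_of_nonneg_left hz' (sub_pos.2 ht1).le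
    have h4 : t * (1 - t) * (coord y α - coord z α) ^ 2 = 0 :=
      le_antisymm (by linarith) (hnn α)
    exact sub_eq_zero.1 (sq_eq_zero_iff.1 ((mul_eq_zero.1 h4).resolve_left htt.ne'))
  refine ⟨?_, hyz⟩
  rw [h, ← hyz, ← add_smul, add_sub_cancel, one_smul]

theorem IsSeparated.normEqL2 {x : JT} (hx : IsSeparated x) (hR : IsChainForest (ran x)) :
    NormEqL2 x := by
  refine ⟨summable_coord_sq x, ?_⟩
  rw [← le_antisymm (hx.norm_sq_le_tsum hR) (tsum_coord_sq_le x), Real.sqrt_sq (norm_nonneg x)]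

/-! ### Supports in incomparable segments -/

theorem exists_mem_of_le {F : Set Segment} (hF : F.Pairwise Incomparable) {α β : Tree}
    (hα : α ∈ ⋃ S ∈ F, S.nodes) (hβ : β ∈ ⋃ S ∈ F, S.nodes) (h : α ≤ β) :
    ∃ S ∈ F, α ∈ S.nodes ∧ β ∈ S.nodes := by
  simp only [Set.mem_iUnion, exists_prop] at hα hβ
  obtain ⟨S, hS, hαS⟩ := hα
  obtain ⟨T, hT, hβT⟩ := hβ
  by_cases hST : S = T
  · exact ⟨S, hS, hαS, hST ▸ hβT⟩
  · exact absurd h (hF hS hT hST α hαS β hβT).1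

theorem isChainForest_ran {x : JT} {F : Set Segment} (hF : F.Pairwise Incomparable)
    (hx : supp x ⊆ ⋃ S ∈ F, S.nodes) : IsChainForest (ran x) := by
  -- Comparable nodes of the union share a segment, so the union is order-convex and contains the
  -- range along with the support.
  have hsub : ran x ⊆ ⋃ S ∈ F, S.nodes := by
    refine Set.sInter_subset_of_mem ⟨⟨fun α hα β hβ γ hγ => ?_⟩, hx⟩
    obtain ⟨S, hS, h1, h2⟩ := exists_mem_of_le hF hα hβ (hγ.1.trans hγ.2)
    exact Set.mem_biUnion hS (S.isSegment.1.out h1 h2 hγ)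
  intro α hα β hβ γ hγ h1 h2
  obtain ⟨S, hS, hγS, hαS⟩ := exists_mem_of_le hF (hsub hγ) (hsub hα) h1
  obtain ⟨T, hT, hγT, hβT⟩ := exists_mem_of_le hF (hsub hγ) (hsub hβ) h2
  by_cases hST : S = T
  · exact S.isSegment.le_total hαS (hST ▸ hβT)
  · exact absurd le_rfl (hF hS hT hST γ hγS γ hγT).1

end JT

end JamesTree

end

theorem mainTheorem11 (x : JamesTree.JT) (hx : JamesTree.JT.IsSeparated x) :
    ((∃ b : Set JamesTree.Tree, JamesTree.IsBranch b ∧ JamesTree.JT.supp x ⊆ b) →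
      JamesTree.JT.NormEqL2 x ∧ (x ≠ 0 → JamesTree.JT.IsExtreme x)) ∧
    (∀ F : Set JamesTree.Segment, F.Pairwise JamesTree.Incomparable →
      JamesTree.JT.supp x ⊆ ⋃ S ∈ F, S.nodes →
      JamesTree.JT.NormEqL2 x ∧ (x ≠ 0 → JamesTree.JT.IsExtreme x)) := by
  have key : ∀ F : Set JamesTree.Segment, F.Pairwise JamesTree.Incomparable →
      JamesTree.JT.supp x ⊆ ⋃ S ∈ F, S.nodes →
      JamesTree.JT.NormEqL2 x ∧ (x ≠ 0 → JamesTree.JT.IsExtreme x) := fun F hF hsupp =>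
    have h := hx.normEqL2 (JamesTree.JT.isChainForest_ran hF hsupp)
    ⟨h, h.isExtreme⟩
  refine ⟨?_, key⟩
  rintro ⟨b, hb, hsupp⟩
  -- A branch is a family with one member, for which incomparability is vacuous.
  refine key {JamesTree.Segment.ofSet b} (Set.pairwise_singleton _ _) ?_
  rwa [Set.biUnion_singleton, JamesTree.Segment.nodes_ofSet (Maximal.prop hb)]
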